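/- Let $a,q,\alpha,\beta,\gamma,\delta,\varepsilon\in\mathbb C$ satisfy the Fuchsian relation $1+\alpha+\beta=\gamma+\delta+\varepsilon$ and $$a=\tfrac12,\qquad \gamma+\delta=2,\qquad q=a\alpha\beta+a(1-\delta)\varepsilon .$$ Assume that $\operatorname{Re}\gamma>1$ and that none of $\gamma+\varepsilon$, $\frac{\gamma+\alpha}{2}$, $\frac{\gamma+\beta}{2}$ is zero or a negative integer. Consider the hypergeometric expansion associated with the general Heun equation with these parameters, $$u(z)=\sum_{n=0}^{\infty}a_n\,{}_2F_1(\alpha,\beta;\gamma+\varepsilon+n;z),\qquad |z|\le 1,$$ where $a_0=1$, $a_{-1}=0$ and, for $n\ge1$, $R_na_n+Q_{n-1}a_{n-1}+P_{n-2}a_{n-2}=0$ with $$R_n=(1-a)n(\varepsilon+\gamma+n-1),\qquad Q_n=-R_n+a(1+n-\delta)(n+\varepsilon)+(a\alpha\beta-q),$$ $$P_n=-\frac{a}{n+\varepsilon+\gamma}(n+\varepsilon)(n+\varepsilon+\gamma-\alpha)(n+\varepsilon+\gamma-\beta)$$ (the term with $P_{-1}$ is absent). Then the series of every ${}_2F_1(\alpha,\beta;\gamma+\varepsilon+n;z)$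 and the expansion itself converge absolutely for $|z|\le1$, the function $u$ on the closed unit disc is continuous at $z=1$, the ${}_3F_2$ series below converges absolutely, and $$u(1)=\frac{\Gamma(\gamma+\varepsilon)\,\Gamma(\gamma-1)}{\Gamma(\gamma+\varepsilon-\alpha)\,\Gamma(\gamma-1+\alpha)}\;{}_3F_2\!\left(\frac{\gamma-1}{2},\frac{\gamma}{2},\frac{\varepsilon}{2};\frac{\gamma+\alpha}{2},\frac{\gamma+\beta}{2};1\right),$$ where $1/\Gamma$ is read as $0$ at the poles of $\Gamma$. -/

import Mathlib

noncomputable section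

/-- Coefficient `R_n = (1 - a) n (γ + ε + n - 1)` of the three-term recurrence relation. -/
def heunR (a γ ε : ℂ) (n : ℕ) : ℂ :=
  (1 - a) * n * (ε + γ + n - 1)

/-- Coefficient `Q_n = -R_n + a (1 + n - δ) (n + ε) + (a α β - q)`. -/
def heunQ (a q α β γ δ ε : ℂ) (n : ℕ) : ℂ :=
  -heunR a γ ε n + a * (1 + n - δ) * (n + ε) + (a * α * β - q)

/-- Coefficient
`P_n = -a / (n + ε + γ) * (n + ε) (n + ε + γ - α) (n + ε + γ - β)`. -/
def heunP (a α β γ ε : ℂ) (n : ℕ) : ℂ :=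
  -(a / (n + ε + γ)) * (n + ε) * (n + ε + γ - α) * (n + ε + γ - β)

/-- The coefficients of the hypergeometric expansion for the general Heun equation: `a_0 = 1`,
and `R_n a_n + Q_{n-1} a_{n-1} + P_{n-2} a_{n-2} = 0` for `n ≥ 1`, with `a_{-1} = 0`.
The recurrence determines them when `a ≠ 1` and `γ + ε` is not a non-positive integer. -/
def heunCoeff (a q α β γ δ ε : ℂ) : ℕ → ℂ
  | 0 => 1
  | 1 => -(heunQ a q α β γ δ ε 0) / heunR a γ ε 1
  | n + 2 =>
      -(heunQ a q α β γ δ ε (n + 1) * heunCoeff a q α β γ δ ε (n + 1)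
        + heunP a α β γ ε n * heunCoeff a q α β γ δ ε n) / heunR a γ ε (n + 2)

/-- The `n`-th term `a_n * ₂F₁(α, β; γ + ε + n; z)` of the expansion. -/
def heunTerm (a q α β γ δ ε : ℂ) (z : ℂ) (n : ℕ) : ℂ :=
  heunCoeff a q α β γ δ ε n * ordinaryHypergeometric α β (γ + ε + n) z

/-- The expansion `u(z) = ∑ a_n * ₂F₁(α, β; γ + ε + n; z)`. -/
def heunExpansion (a q α β γ δ ε : ℂ) (z : ℂ) : ℂ :=
  ∑' n : ℕ, heunTerm a q α β γ δ ε z n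

/-- The `k`-th term of Clausen's series `₃F₂(a₁, a₂, a₃; b₁, b₂; z)`. -/
def clausenTerm (a₁ a₂ a₃ b₁ b₂ z : ℂ) (k : ℕ) : ℂ :=
  (ascPochhammer ℂ k).eval a₁ * (ascPochhammer ℂ k).eval a₂ * (ascPochhammer ℂ k).eval a₃ /
    ((ascPochhammer ℂ k).eval b₁ * (ascPochhammer ℂ k).eval b₂ * (k.factorial : ℂ)) * z ^ k

/-- Clausen's generalized hypergeometric function `₃F₂(a₁, a₂, a₃; b₁, b₂; z)`. -/
def clausen (a₁ a₂ a₃ b₁ b₂ z : ℂ) : ℂ :=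
  ∑' k : ℕ, clausenTerm a₁ a₂ a₃ b₁ b₂ z k

end

section HypergeometricExpansion

open Filter Asymptotics Complex Polynomial
open scoped Topology Nat

/-! For these parameters `Q_n` vanishes identically, so the recurrence links `a_{n+2}` to `a_n`
alone: odd coefficients are zero and even ones are explicit Pochhammer quotients of size `O(k⁻²)`.
Since `(γ + ε + n) - α - β = γ - 1 + n` and `Re γ > 1`, each `₂F₁` converges absolutely on the
closed disc, with a bound uniform in `n`. The Weierstrass M-test then gives absolute convergence of
the expansion and continuity up to the boundary.

At `z = 1` Gauss's theorem evaluates each `₂F₁`. Splitting the `(·)_{2k}` by duplication cancels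
four Pochhammer factors and leaves a constant times the `k`-th Clausen term
(`heunTerm_one_even_special`). -/

/-! ### Growth of Pochhammer symbols. -/

theorem ascPochhammer_eval_eq_prod_range (x : ℂ) (n : ℕ) :
    (ascPochhammer ℂ n).eval x = ∏ j ∈ Finset.range n, (x + j) := by
  induction n with
  | zero => simp
  | succ n ih => rw [ascPochhammer_succ_eval, Finset.prod_range_succ, ih]

theorem GammaSeq_eq_div_ascPochhammer (x : ℂ) (n : ℕ) :
    GammaSeq x n = (n : ℂ) ^ x * n ! / (ascPochhammer ℂ (n + 1)).eval x := by
  rw [GammaSeq, ascPochhammer_eval_eq_prod_range]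

theorem natCast_cpow_mul_factorial_ne_zero (x : ℂ) {n : ℕ} (hn : n ≠ 0) :
    (n : ℂ) ^ x * n ! ≠ 0 :=
  mul_ne_zero (by simp [cpow_eq_zero_iff, hn]) (by exact_mod_cast n.factorial_ne_zero)

theorem ascPochhammer_succ_eq_inv_GammaSeq (x : ℂ) {n : ℕ} (hn : n ≠ 0) :
    (ascPochhammer ℂ (n + 1)).eval x = ((n : ℂ) ^ x * n !) * (GammaSeq x n)⁻¹ := by
  rw [GammaSeq_eq_div_ascPochhammer, inv_div,
    mul_div_cancel₀ _ (natCast_cpow_mul_factorial_ne_zero x hn)]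

/-- The reciprocal form of Euler's limit formula, valid also at the poles of `Γ`. -/
theorem tendsto_inv_GammaSeq (x : ℂ) :
    Tendsto (fun n => (GammaSeq x n)⁻¹) atTop (𝓝 (Gamma x)⁻¹) := by
  by_cases h : ∃ m : ℕ, x = -m
  · obtain ⟨m, rfl⟩ := h
    rw [Gamma_neg_nat_eq_zero, inv_zero]
    refine tendsto_const_nhds.congr' ?_
    filter_upwards [eventually_ge_atTop m] with n hn
    rw [GammaSeq_eq_div_ascPochhammer,
      (ascPochhammer_eval_eq_zero_iff _ _).2 ⟨m, by lia, by simp⟩, div_zero, inv_zero]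
  · push Not at h
    exact (GammaSeq_tendsto_Gamma x).inv₀ (Gamma_ne_zero h)

theorem norm_natCast_cpow_mul_factorial (x : ℂ) {n : ℕ} (hn : n ≠ 0) :
    ‖(n : ℂ) ^ x * (n ! : ℂ)‖ = (n : ℝ) ^ x.re * (n ! : ℝ) := by
  rw [norm_mul, norm_natCast_cpow_of_pos (Nat.pos_of_ne_zero hn), norm_natCast]

theorem isBigO_ascPochhammer (x : ℂ) :
    (fun n : ℕ => (ascPochhammer ℂ (n + 1)).eval x) =O[atTop]
      fun n : ℕ => (n : ℝ) ^ x.re * (n ! : ℝ) := by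
  have h := (isBigO_refl (fun n : ℕ => (n : ℝ) ^ x.re * (n ! : ℝ)) atTop).mul
    ((tendsto_inv_GammaSeq x).isBigO_one ℝ).norm_left
  simp only [mul_one] at h
  refine IsBigO.trans (IsBigO.of_bound 1 ?_) h.norm_left
  filter_upwards [eventually_ne_atTop 0] with n hn
  rw [ascPochhammer_succ_eq_inv_GammaSeq x hn, norm_mul, norm_natCast_cpow_mul_factorial x hn]
  simp [norm_mul, abs_of_nonneg, Real.rpow_nonneg]

/-- No condition on `x` is needed: at a pole of `Γ` the symbol is eventually `0`, and so is its
inverse under `0⁻¹ = 0`. -/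
theorem isBigO_inv_ascPochhammer (x : ℂ) :
    (fun n : ℕ => ((ascPochhammer ℂ (n + 1)).eval x)⁻¹) =O[atTop]
      fun n : ℕ => ((n : ℝ) ^ x.re * (n ! : ℝ))⁻¹ := by
  have h := (isBigO_refl (fun n : ℕ => ((n : ℝ) ^ x.re * (n ! : ℝ))⁻¹) atTop).mul
    ((GammaSeq_tendsto_Gamma x).isBigO_one ℝ).norm_left
  simp only [mul_one] at h
  refine IsBigO.trans (IsBigO.of_bound 1 ?_) h.norm_left
  filter_upwards [eventually_ne_atTop 0] with n hn
  rw [ascPochhammer_succ_eq_inv_GammaSeq x hn, norm_inv, norm_mul,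
    norm_natCast_cpow_mul_factorial x hn]
  simp [norm_mul, abs_of_nonneg, Real.rpow_nonneg, mul_comm]

/-- A quotient of Pochhammer symbols, the coefficient of `₃F₂` up to normalization. -/
theorem isBigO_ascPochhammer_ratio (a₁ a₂ a₃ b₁ b₂ b₃ : ℂ) :
    (fun n : ℕ => (ascPochhammer ℂ (n + 1)).eval a₁ * (ascPochhammer ℂ (n + 1)).eval a₂ *
      (ascPochhammer ℂ (n + 1)).eval a₃ * ((ascPochhammer ℂ (n + 1)).eval b₁)⁻¹ *
      ((ascPochhammer ℂ (n + 1)).eval b₂)⁻¹ * ((ascPochhammer ℂ (n + 1)).eval b₃)⁻¹) =O[atTop]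
      fun n : ℕ => (n : ℝ) ^ (a₁ + a₂ + a₃ - b₁ - b₂ - b₃).re := by
  refine ((((((isBigO_ascPochhammer a₁).mul (isBigO_ascPochhammer a₂)).mul
    (isBigO_ascPochhammer a₃)).mul (isBigO_inv_ascPochhammer b₁)).mul
    (isBigO_inv_ascPochhammer b₂)).mul (isBigO_inv_ascPochhammer b₃)).congr' EventuallyEq.rfl ?_
  filter_upwards [eventually_gt_atTop 0] with n hn
  have h : (0 : ℝ) < n := by exact_mod_cast hn
  have hf : (n ! : ℝ) ≠ 0 := by exact_mod_cast n.factorial_ne_zero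
  simp only [sub_re, add_re, Real.rpow_sub h, Real.rpow_add h]
  field_simp

theorem summable_ascPochhammer_ratio {a₁ a₂ a₃ b₁ b₂ b₃ : ℂ}
    (h : (a₁ + a₂ + a₃ - b₁ - b₂ - b₃).re < -1) :
    Summable fun n : ℕ => (ascPochhammer ℂ n).eval a₁ * (ascPochhammer ℂ n).eval a₂ *
      (ascPochhammer ℂ n).eval a₃ * ((ascPochhammer ℂ n).eval b₁)⁻¹ *
      ((ascPochhammer ℂ n).eval b₂)⁻¹ * ((ascPochhammer ℂ n).eval b₃)⁻¹ :=
  (summable_nat_add_iff 1).1 <| summable_of_isBigO_nat (Real.summable_nat_rpow.2 h)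
    (isBigO_ascPochhammer_ratio a₁ a₂ a₃ b₁ b₂ b₃)

/-! ### `₂F₁` at `1` and Gauss's theorem. -/

theorem ordinaryHypergeometricCoefficient_eq_ratio (a b c : ℂ) (n : ℕ) :
    ordinaryHypergeometricCoefficient a b c n =
      (ascPochhammer ℂ n).eval a * (ascPochhammer ℂ n).eval b *
      (ascPochhammer ℂ n).eval 1 * ((ascPochhammer ℂ n).eval c)⁻¹ *
      ((ascPochhammer ℂ n).eval 1)⁻¹ * ((ascPochhammer ℂ n).eval 1)⁻¹ := by
  have hf : (n ! : ℂ) ≠ 0 := by exact_mod_cast n.factorial_ne_zero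
  simp only [ascPochhammer_eval_one]
  field_simp

theorem summable_ordinaryHypergeometricCoefficient {a b c : ℂ} (h : (a + b).re < c.re) :
    Summable (ordinaryHypergeometricCoefficient a b c) := by
  refine (summable_ascPochhammer_ratio (a₁ := a) (a₂ := b) (a₃ := 1) (b₁ := c) (b₂ := 1) (b₃ := 1)
    ?_).congr fun n => (ordinaryHypergeometricCoefficient_eq_ratio a b c n).symm
  simp at h ⊢
  linarith

theorem tendsto_natCast_mul_ordinaryHypergeometricCoefficient {a b c : ℂ}
    (h : (a + b).re < c.re) :
    Tendsto (fun n : ℕ => (n : ℂ) * ordinaryHypergeometricCoefficient a b c n) atTop (𝓝 0) := by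
  refine (tendsto_add_atTop_iff_nat 1).1 ?_
  have hO : (fun n : ℕ => ((n + 1 : ℕ) : ℂ) * ordinaryHypergeometricCoefficient a b c (n + 1))
      =O[atTop] fun n : ℕ => (n : ℝ) ^ (a + b + 1 - c - 1 - 0).re := by
    have h1 : (fun n : ℕ => ((n + 1 : ℕ) : ℂ)) =O[atTop] fun n : ℕ => (n : ℝ) := by
      refine IsBigO.of_bound 2 ?_
      filter_upwards [eventually_ge_atTop 1] with n hn
      have : (1 : ℝ) ≤ n := by exact_mod_cast hn
      rw [norm_natCast, Real.norm_natCast]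
      push_cast
      linarith
    have h2 := h1.mul (isBigO_ascPochhammer_ratio a b 1 c 1 1)
    refine h2.congr' ?_ ?_
    · exact Eventually.of_forall fun n => by
        simp only [← ordinaryHypergeometricCoefficient_eq_ratio]
    · filter_upwards [eventually_gt_atTop 0] with n hn
      rw [← Real.rpow_one_add' (Nat.cast_nonneg n)]
      · congr 1
        simp
      · simp at h ⊢
        intro h'
        linarith
  refine hO.trans_tendsto ?_
  have h3 : (a + b + 1 - c - 1 - 0).re = -(c.re - (a + b).re) := by simp; ring
  rw [h3]
  exact (tendsto_rpow_neg_atTop (by linarith)).comp tendsto_natCast_atTop_atTop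

/-- One step of the shift `c ↦ c + 1` in the third parameter of `₂F₁(a, b; c; 1)`. -/
theorem tsum_ordinaryHypergeometricCoefficient_shift {a b c : ℂ} (h : (a + b).re < c.re)
    (hc : ∀ m : ℕ, c ≠ -m) :
    c * (c - a - b) * ∑' n, ordinaryHypergeometricCoefficient a b c n =
      (c - a) * (c - b) * ∑' n, ordinaryHypergeometricCoefficient a b (c + 1) n := by
  have hA := summable_ordinaryHypergeometricCoefficient h
  have hB := summable_ordinaryHypergeometricCoefficient (a := a) (b := b) (c := c + 1)
    (h.trans (by simp))
  have hcn (n : ℕ) : c + n ≠ 0 := fun h0 => hc n (eq_neg_of_add_eq_zero_left h0)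
  have hS := (hB.mul_left ((c - a) * (c - b))).hasSum.sub
    (hA.mul_left (c * (c - a - b))).hasSum
  -- The difference of the two series telescopes; the boundary term tends to `0` because `Re (c - a
  -- - b) > 0`.
  have hT : ∀ N : ℕ, ∑ n ∈ Finset.range N,
      ((c - a) * (c - b) * ordinaryHypergeometricCoefficient a b (c + 1) n -
        c * (c - a - b) * ordinaryHypergeometricCoefficient a b c n) =
      c * (N * ordinaryHypergeometricCoefficient a b c N) := by
    intro N
    induction N with
    | zero => simp
    | succ n ih =>
      have hp : (ascPochhammer ℂ n).eval c ≠ 0 := fun h0 => by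
        obtain ⟨k, -, hk⟩ := (ascPochhammer_eval_eq_zero_iff _ _).1 h0
        exact hc k (by rw [hk, neg_neg])
      have hf : (n ! : ℂ) ≠ 0 := by exact_mod_cast n.factorial_ne_zero
      have hn1 : (n : ℂ) + 1 ≠ 0 := by exact_mod_cast n.succ_ne_zero
      have hs : c * (ascPochhammer ℂ n).eval (c + 1) = (ascPochhammer ℂ n).eval c * (c + n) := by
        rw [← ascPochhammer_succ_eval, ascPochhammer_succ_left]
        simp
      have hc0 : c ≠ 0 := by simpa using hcn 0
      have hs' : ((ascPochhammer ℂ n).eval (c + 1))⁻¹ =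
          c * ((ascPochhammer ℂ n).eval c * (c + n))⁻¹ := by
        rw [← hs]
        field_simp
      rw [Finset.sum_range_succ, ih]
      simp only [ordinaryHypergeometricCoefficient, ascPochhammer_succ_eval, Nat.factorial_succ,
        hs']
      push_cast
      have := hcn n
      field_simp
      ring
  have h0 := hS.tendsto_sum_nat
  simp only [hT] at h0
  have h1 := tendsto_nhds_unique h0
    ((tendsto_natCast_mul_ordinaryHypergeometricCoefficient h).const_mul c)
  rw [tsum_mul_left, tsum_mul_left, mul_zero, sub_eq_zero] at h1
  exact h1.symm

theorem norm_ascPochhammer_eval_le {σ : ℝ} (hσ : 0 < σ) {w : ℂ} (hw : σ ≤ w.re) (n : ℕ) :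
    ‖(ascPochhammer ℂ n).eval (σ : ℂ)‖ ≤ ‖(ascPochhammer ℂ n).eval w‖ := by
  simp only [ascPochhammer_eval_eq_prod_range, norm_prod]
  refine Finset.prod_le_prod (fun _ _ => norm_nonneg _) fun j _ => ?_
  calc ‖(σ : ℂ) + j‖ = σ + j := by
        rw [← ofReal_natCast, ← ofReal_add, norm_real, Real.norm_of_nonneg (by positivity)]
    _ ≤ (w + j).re := by simpa using hw
    _ ≤ ‖w + j‖ := re_le_norm _

/-- A single real parameter `σ` gives a majorant for the whole half-plane `Re w ≥ σ`, hence for all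
large shifts `c + m`. -/
theorem norm_ordinaryHypergeometricCoefficient_le (a b : ℂ) {σ : ℝ} (hσ : 0 < σ) {w : ℂ}
    (hw : σ ≤ w.re) (n : ℕ) :
    ‖ordinaryHypergeometricCoefficient a b w n‖ ≤
      ‖ordinaryHypergeometricCoefficient a b σ n‖ := by
  simp only [ordinaryHypergeometricCoefficient, norm_mul, norm_inv]
  gcongr
  · rw [norm_pos_iff]
    intro h0
    obtain ⟨k, -, hk⟩ := (ascPochhammer_eval_eq_zero_iff _ _).1 h0
    have := congrArg re hk
    simp at this
    have : (0 : ℝ) ≤ k := Nat.cast_nonneg k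
    linarith
  · exact norm_ascPochhammer_eval_le hσ hw n

/-- By dominated convergence only the constant term survives, since `(c + m)_n → ∞` for each `n ≥
1`. -/
theorem tendsto_tsum_ordinaryHypergeometricCoefficient_atTop (a b c : ℂ) :
    Tendsto (fun m : ℕ => ∑' n, ordinaryHypergeometricCoefficient a b (c + m) n) atTop (𝓝 1) := by
  have h1 : ∑' n : ℕ, (if n = 0 then (1 : ℂ) else 0) = 1 := by simp
  rw [← h1]
  -- The first entry makes `σ` positive, the second makes the majorant series converge.
  set σ : ℝ := max 1 ((a + b).re + 1) with hσ
  have hσ0 : 0 < σ := lt_of_lt_of_le one_pos (le_max_left _ _)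
  refine tendsto_tsum_of_dominated_convergence
    (summable_ordinaryHypergeometricCoefficient (a := a) (b := b) (c := σ) ?_).norm ?_ ?_
  · rw [ofReal_re]
    exact (lt_add_one _).trans_le (le_max_right _ _)
  · intro n
    rcases n with _ | n
    · simp [ordinaryHypergeometricCoefficient]
    · have ht : Tendsto (fun m : ℕ => ‖c + m‖) atTop atTop := by
        refine tendsto_atTop_mono (fun m => ?_) (tendsto_atTop_add_const_left atTop c.re
          tendsto_natCast_atTop_atTop)
        simpa using re_le_norm (c + m)
      have hd : 0 < (ascPochhammer ℂ (n + 1)).degree := by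
        rw [← natDegree_pos_iff_degree_pos, ascPochhammer_natDegree]
        exact n.succ_pos
      have := (tendsto_inv₀_cobounded.comp (tendsto_norm_atTop_iff_cobounded.1
        (Polynomial.tendsto_norm_atTop _ hd ht))).const_mul
        ((((n + 1) ! : ℕ) : ℂ)⁻¹ * (ascPochhammer ℂ (n + 1)).eval a *
          (ascPochhammer ℂ (n + 1)).eval b)
      simpa using this
  · filter_upwards [eventually_ge_atTop ⌈σ - c.re⌉₊] with m hm n
    refine norm_ordinaryHypergeometricCoefficient_le a b hσ0 ?_ n
    have := Nat.ceil_le.1 hm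
    simp
    linarith

/-- **Gauss's summation theorem** for `₂F₁(a, b; c; 1)`. -/
theorem tsum_ordinaryHypergeometricCoefficient {a b c : ℂ} (h : (a + b).re < c.re)
    (hc : ∀ m : ℕ, c ≠ -m) :
    ∑' n, ordinaryHypergeometricCoefficient a b c n =
      Gamma c * Gamma (c - a - b) * ((Gamma (c - a))⁻¹ * (Gamma (c - b))⁻¹) := by
  have hd : 0 < (c - a - b).re := by simp at h ⊢; linarith
  have hd' (m : ℕ) : c - a - b ≠ -m := fun h0 => by
    have := congrArg re h0
    have h2 : (0 : ℝ) ≤ m := Nat.cast_nonneg m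
    simp at this hd
    linarith
  have hne {x : ℂ} (hx : ∀ m : ℕ, x ≠ -m) (m : ℕ) : (ascPochhammer ℂ m).eval x ≠ 0 := fun h0 => by
    obtain ⟨k, -, hk⟩ := (ascPochhammer_eval_eq_zero_iff _ _).1 h0
    exact hx k (by rw [hk, neg_neg])
  -- Iterating the shift and letting `m → ∞` turns the Pochhammer quotient into Gamma values by
  -- Euler's limit; the powers of `m` cancel because `c + (c - a - b) = (c - a) + (c - b)`.
  have hstep (m : ℕ) : (ascPochhammer ℂ m).eval c * (ascPochhammer ℂ m).eval (c - a - b) *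
      ∑' n, ordinaryHypergeometricCoefficient a b c n =
      (ascPochhammer ℂ m).eval (c - a) * (ascPochhammer ℂ m).eval (c - b) *
      ∑' n, ordinaryHypergeometricCoefficient a b (c + m) n := by
    induction m with
    | zero => simp
    | succ m ih =>
      have h3 : (a + b).re < (c + m).re := by
        have h2 : (0 : ℝ) ≤ m := Nat.cast_nonneg m
        simp at h ⊢
        linarith
      have := tsum_ordinaryHypergeometricCoefficient_shift h3 fun k hk => hc (k + m) (by
        push_cast
        linear_combination hk)
      simp only [ascPochhammer_succ_eval]
      push_cast
      rw [← add_assoc]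
      linear_combination (c + m) * (c + m - a - b) * ih +
        (ascPochhammer ℂ m).eval (c - a) * (ascPochhammer ℂ m).eval (c - b) * this
  have hlim := (((GammaSeq_tendsto_Gamma c).mul (GammaSeq_tendsto_Gamma (c - a - b))).mul
    ((tendsto_inv_GammaSeq (c - a)).mul (tendsto_inv_GammaSeq (c - b)))).mul
    ((tendsto_tsum_ordinaryHypergeometricCoefficient_atTop a b c).comp (tendsto_add_atTop_nat 1))
  rw [mul_one] at hlim
  refine tendsto_nhds_unique (tendsto_const_nhds.congr' ?_) hlim
  filter_upwards [eventually_ne_atTop 0] with m hm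
  have hm' : (m : ℂ) ≠ 0 := by exact_mod_cast hm
  have e : (m : ℂ) ^ c * (m : ℂ) ^ (c - a - b) = (m : ℂ) ^ (c - a) * (m : ℂ) ^ (c - b) := by
    rw [← cpow_add _ _ hm', ← cpow_add _ _ hm']
    congr 1
    ring
  have hs := hstep (m + 1)
  have n1 := natCast_cpow_mul_factorial_ne_zero (c - a) hm
  have n2 := natCast_cpow_mul_factorial_ne_zero (c - b) hm
  simp only [GammaSeq_eq_div_ascPochhammer, inv_div, Function.comp_apply]
  have h1 := hne hc (m + 1)
  have h2 := hne hd' (m + 1)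
  generalize ∑' n, ordinaryHypergeometricCoefficient a b c n = F at *
  generalize ∑' n, ordinaryHypergeometricCoefficient a b (c + (m + 1 : ℕ)) n = G at *
  have e' : (m : ℂ) ^ c * m ! * ((m : ℂ) ^ (c - a - b) * m !) =
      (m : ℂ) ^ (c - a) * m ! * ((m : ℂ) ^ (c - b) * m !) := by
    linear_combination (m ! : ℂ) ^ 2 * e
  rw [div_mul_div_comm, div_mul_div_comm, e', div_mul_div_comm, div_mul_eq_mul_div,
    eq_div_iff (mul_ne_zero (mul_ne_zero h1 h2) (mul_ne_zero n1 n2))]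
  linear_combination ((m : ℂ) ^ (c - a) * m ! * ((m : ℂ) ^ (c - b) * m !)) * hs

/-! ### Gamma shifts and duplication. -/

/-- `(x)_n / Γ(x + n) = 1 / Γ(x)`, valid also at the poles of `Γ`. -/
theorem ascPochhammer_eval_mul_inv_Gamma (x : ℂ) (n : ℕ) :
    (ascPochhammer ℂ n).eval x * (Gamma (x + n))⁻¹ = (Gamma x)⁻¹ := by
  induction n with
  | zero => simp
  | succ n ih =>
    rw [← ih, one_div_Gamma_eq_self_mul_one_div_Gamma_add_one (x + n), ascPochhammer_succ_eval]
    push_cast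
    rw [← add_assoc]
    ring

theorem Gamma_add_natCast {x : ℂ} (hx : ∀ m : ℕ, x ≠ -m) (n : ℕ) :
    Gamma (x + n) = (ascPochhammer ℂ n).eval x * Gamma x := by
  rw [← Gamma_add_nat_div_Gamma_eq x hx, div_mul_cancel₀ _ (Gamma_ne_zero hx)]

/-- The duplication formula for Pochhammer symbols. -/
theorem ascPochhammer_two_mul_eval (x : ℂ) (n : ℕ) :
    (ascPochhammer ℂ (2 * n)).eval x =
      4 ^ n * (ascPochhammer ℂ n).eval (x / 2) * (ascPochhammer ℂ n).eval ((x + 1) / 2) := by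
  induction n with
  | zero => simp
  | succ n ih =>
    rw [show 2 * (n + 1) = 2 * n + 1 + 1 by ring]
    simp only [ascPochhammer_succ_eval, ih]
    push_cast
    ring

/-! ### `₂F₁` on the closed unit disc. -/

theorem ordinaryHypergeometric_eq_tsum_coefficient (a b c z : ℂ) :
    ordinaryHypergeometric a b c z = ∑' n, ordinaryHypergeometricCoefficient a b c n * z ^ n := by
  simp only [ordinaryHypergeometric_eq_tsum, smul_eq_mul]

theorem norm_coefficient_mul_pow_le (a b c : ℂ) {z : ℂ} (hz : ‖z‖ ≤ 1) (n : ℕ) :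
    ‖ordinaryHypergeometricCoefficient a b c n * z ^ n‖ ≤
      ‖ordinaryHypergeometricCoefficient a b c n‖ := by
  rw [norm_mul, norm_pow]
  exact mul_le_of_le_one_right (norm_nonneg _) (pow_le_one₀ (norm_nonneg _) hz)

theorem continuousOn_ordinaryHypergeometric {a b c : ℂ} (h : (a + b).re < c.re) :
    ContinuousOn (ordinaryHypergeometric a b c) (Metric.closedBall (0 : ℂ) 1) := by
  rw [funext (ordinaryHypergeometric_eq_tsum_coefficient a b c)]
  refine continuousOn_tsum (fun n => by fun_prop)
    (summable_ordinaryHypergeometricCoefficient h).norm fun n z hz => ?_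
  exact norm_coefficient_mul_pow_le a b c (by simpa using hz) n

theorem norm_ordinaryHypergeometric_le {a b c : ℂ} (h : (a + b).re < c.re) {z : ℂ}
    (hz : ‖z‖ ≤ 1) :
    ‖ordinaryHypergeometric a b c z‖ ≤ ∑' n, ‖ordinaryHypergeometricCoefficient a b c n‖ := by
  rw [ordinaryHypergeometric_eq_tsum_coefficient]
  exact tsum_of_norm_bounded (summable_ordinaryHypergeometricCoefficient h).norm.hasSum
    fun n => norm_coefficient_mul_pow_le a b c hz n

/-- The functions `₂F₁(a, b; c + n; z)` are uniformly bounded on the closed unit disc. -/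
theorem exists_norm_ordinaryHypergeometric_add_natCast_le {a b c : ℂ} (h : (a + b).re < c.re) :
    ∃ C : ℝ, ∀ (n : ℕ) (z : ℂ), ‖z‖ ≤ 1 → ‖ordinaryHypergeometric a b (c + n) z‖ ≤ C := by
  have hre (n : ℕ) : (a + b).re < (c + n).re := by
    have h2 : (0 : ℝ) ≤ n := Nat.cast_nonneg n
    simp at h ⊢
    linarith
  set σ : ℝ := max 1 ((a + b).re + 1) with hσ
  have hσ0 : 0 < σ := lt_of_lt_of_le one_pos (le_max_left _ _)
  have hσs : (a + b).re < (σ : ℂ).re := by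
    rw [ofReal_re]
    exact (lt_add_one _).trans_le (le_max_right _ _)
  set K : ℕ → ℝ := fun n => ∑' j, ‖ordinaryHypergeometricCoefficient a b (c + n) j‖ with hK
  have hK0 (n : ℕ) : 0 ≤ K n := tsum_nonneg fun j => norm_nonneg _
  -- Only finitely many `n` have `Re (c + n) < σ`; their bounds are added to the common majorant.
  refine ⟨∑ n ∈ Finset.range ⌈σ - c.re⌉₊, K n +
    ∑' j, ‖ordinaryHypergeometricCoefficient a b σ j‖, fun n z hz =>
    (norm_ordinaryHypergeometric_le (hre n) hz).trans ?_⟩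
  by_cases hn : n < ⌈σ - c.re⌉₊
  · exact (Finset.single_le_sum (f := K) (fun i _ => hK0 i) (Finset.mem_range.2 hn)).trans
      (le_add_of_nonneg_right (tsum_nonneg fun j => norm_nonneg _))
  · refine le_trans ?_ (le_add_of_nonneg_left (Finset.sum_nonneg fun i _ => hK0 i))
    refine (summable_ordinaryHypergeometricCoefficient (hre n)).norm.tsum_le_tsum
      (fun j => norm_ordinaryHypergeometricCoefficient_le a b hσ0 ?_ j)
      (summable_ordinaryHypergeometricCoefficient hσs).norm
    have := Nat.ceil_le.1 (not_lt.1 hn)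
    simp
    linarith


/-! ### Heun coefficients and terms in the special case. -/

variable {α β γ : ℂ}

/-- With `a = 1/2` and `1 - δ = γ - 1`, the quadratic and linear parts in `n` cancel against `R_n`;
the value of `q` removes the constant `(γ - 1) ε / 2`. -/
theorem heunQ_special (n : ℕ) :
    heunQ (1 / 2) (1 / 2 * α * β + 1 / 2 * (1 - (2 - γ)) * (α + β - 1)) α β γ (2 - γ)
      (α + β - 1) n = 0 := by
  simp only [heunQ, heunR]
  ring

theorem heunCoeff_odd_special (k : ℕ) :
    heunCoeff (1 / 2) (1 / 2 * α * β + 1 / 2 * (1 - (2 - γ)) * (α + β - 1)) α β γ (2 - γ)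
      (α + β - 1) (2 * k + 1) = 0 := by
  induction k with
  | zero => rw [mul_zero, zero_add, heunCoeff, heunQ_special, neg_zero, zero_div]
  | succ k ih =>
    rw [show 2 * (k + 1) + 1 = 2 * k + 1 + 2 by ring, heunCoeff, heunQ_special, ih]
    simp

theorem heunCoeff_even_special (k : ℕ) :
    heunCoeff (1 / 2) (1 / 2 * α * β + 1 / 2 * (1 - (2 - γ)) * (α + β - 1)) α β γ (2 - γ)
      (α + β - 1) (2 * k) =
      (ascPochhammer ℂ k).eval ((α + β - 1) / 2) *
      (ascPochhammer ℂ k).eval ((γ + (α + β - 1) - α) / 2) *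
      (ascPochhammer ℂ k).eval ((γ + (α + β - 1) - β) / 2) *
      ((ascPochhammer ℂ k).eval ((γ + (α + β - 1)) / 2))⁻¹ *
      ((ascPochhammer ℂ k).eval ((γ + (α + β - 1) + 1) / 2))⁻¹ *
      ((ascPochhammer ℂ k).eval 1)⁻¹ := by
  induction k with
  | zero => simp [heunCoeff]
  | succ k ih =>
    rw [show 2 * (k + 1) = 2 * k + 2 by ring, heunCoeff, heunQ_special, ih]
    simp only [ascPochhammer_succ_eval, heunP, heunR, mul_inv]
    have h1 : ((γ + (α + β - 1)) / 2 + k)⁻¹ = 2 * (2 * k + (α + β - 1) + γ)⁻¹ := by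
      rw [show (γ + (α + β - 1)) / 2 + k = (2 * k + (α + β - 1) + γ) / 2 by ring, inv_div,
        div_eq_mul_inv]
    have h2 : ((γ + (α + β - 1) + 1) / 2 + k)⁻¹ =
        2 * ((α + β - 1) + γ + (2 * k + 2) - 1)⁻¹ := by
      rw [show (γ + (α + β - 1) + 1) / 2 + k = ((α + β - 1) + γ + (2 * k + 2) - 1) / 2 by ring,
        inv_div, div_eq_mul_inv]
    have h3 : ((1 - 1 / 2) * (2 * (k : ℂ) + 2))⁻¹ = (1 + (k : ℂ))⁻¹ := by
      congr 1
      ring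
    rw [h1, h2]
    push_cast
    rw [div_eq_mul_inv, mul_inv, h3]
    ring

/-- The growth exponent of the even coefficients is `-2` for all parameters. -/
theorem summable_heunCoeff_special :
    Summable (heunCoeff (1 / 2) (1 / 2 * α * β + 1 / 2 * (1 - (2 - γ)) * (α + β - 1)) α β γ
      (2 - γ) (α + β - 1)) := by
  refine ((mul_right_injective₀ (two_ne_zero : (2 : ℕ) ≠ 0)).summable_iff ?_).1 ?_
  · intro n hn
    rcases n.even_or_odd' with ⟨k, rfl | rfl⟩
    · exact (hn ⟨k, rfl⟩).elim
    · exact heunCoeff_odd_special k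
  · refine (summable_ascPochhammer_ratio ?_).congr fun k => (heunCoeff_even_special k).symm
    rw [show (α + β - 1) / 2 + (γ + (α + β - 1) - α) / 2 + (γ + (α + β - 1) - β) / 2 -
      (γ + (α + β - 1)) / 2 - (γ + (α + β - 1) + 1) / 2 - 1 = -2 by ring]
    norm_num

theorem heunTerm_one_even_special (hγ : 1 < γ.re) (hγε : ∀ m : ℕ, γ + (α + β - 1) ≠ -(m : ℂ))
    (hγα : ∀ m : ℕ, (γ + α) / 2 ≠ -(m : ℂ)) (hγβ : ∀ m : ℕ, (γ + β) / 2 ≠ -(m : ℂ)) (k : ℕ) :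
    heunTerm (1 / 2) (1 / 2 * α * β + 1 / 2 * (1 - (2 - γ)) * (α + β - 1)) α β γ (2 - γ)
      (α + β - 1) 1 (2 * k) =
      Gamma (γ + (α + β - 1)) * Gamma (γ - 1) /
        (Gamma (γ + (α + β - 1) - α) * Gamma (γ - 1 + α)) *
        clausenTerm ((γ - 1) / 2) (γ / 2) ((α + β - 1) / 2) ((γ + α) / 2) ((γ + β) / 2) 1 k := by
  have hne {x : ℂ} (hx : ∀ m : ℕ, x ≠ -m) : (ascPochhammer ℂ k).eval x ≠ 0 := fun h0 => by
    obtain ⟨j, -, hj⟩ := (ascPochhammer_eval_eq_zero_iff _ _).1 h0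
    exact hx j (by rw [hj, neg_neg])
  set s := γ + (α + β - 1) with hs
  have hG : ∀ m : ℕ, γ - 1 ≠ -(m : ℂ) := fun m h0 => by
    have := congrArg re h0
    have h2 : (0 : ℝ) ≤ m := Nat.cast_nonneg m
    simp at this
    linarith
  have hsum : ordinaryHypergeometric α β (s + (2 * k : ℕ)) 1 =
      Gamma (s + (2 * k : ℕ)) * Gamma (γ - 1 + (2 * k : ℕ)) *
        ((Gamma (s - α + (2 * k : ℕ)))⁻¹ * (Gamma (s - β + (2 * k : ℕ)))⁻¹) := by
    rw [ordinaryHypergeometric_eq_tsum_coefficient]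
    simp only [one_pow, mul_one]
    rw [tsum_ordinaryHypergeometricCoefficient]
    · congr! 3 <;> rw [hs] <;> ring_nf
    · have h2 : (0 : ℝ) ≤ (2 * k : ℕ) := Nat.cast_nonneg _
      rw [hs]
      simp at h2 ⊢
      linarith
    · intro m hm
      refine hγε (m + 2 * k) ?_
      push_cast at hm ⊢
      linear_combination hm
  -- `s - α` and `s - β` may be poles of `Γ`, so their reciprocal Gammas are shifted without
  -- dividing.
  have hα := ascPochhammer_eval_mul_inv_Gamma (s - α) (2 * k)
  have hβ := ascPochhammer_eval_mul_inv_Gamma (s - β) (2 * k)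
  rw [ascPochhammer_two_mul_eval] at hα hβ
  rw [heunTerm, heunCoeff_even_special, ← hs, hsum, Gamma_add_natCast hγε, Gamma_add_natCast hG,
    ascPochhammer_two_mul_eval, ascPochhammer_two_mul_eval, clausenTerm,
    show γ - 1 + α = s - β by rw [hs]; ring, div_eq_mul_inv _ (_ * _ : ℂ), mul_inv, ← hα, ← hβ,
    show (γ + α) / 2 = (s - β + 1) / 2 by rw [hs]; ring,
    show (γ + β) / 2 = (s - α + 1) / 2 by rw [hs]; ring, ascPochhammer_eval_one,
    show (γ - 1 + 1) / 2 = γ / 2 by ring, one_pow, mul_one]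
  have e1 := hne (x := s / 2) fun m hm => hγε (2 * m) (by push_cast; linear_combination 2 * hm)
  have e2 := hne (x := (s + 1) / 2) fun m hm => hγε (2 * m + 1)
    (by push_cast; linear_combination 2 * hm)
  have e3 := hne (x := (s - β + 1) / 2) (by convert hγα using 3; rw [hs]; ring)
  have e4 := hne (x := (s - α + 1) / 2) (by convert hγβ using 3; rw [hs]; ring)
  -- Both sides equal `1`. This isolates the only cancellations that need nonvanishing; the rest is
  -- a ring identity.
  have e : (ascPochhammer ℂ k).eval (s / 2) * ((ascPochhammer ℂ k).eval (s / 2))⁻¹ *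
      ((ascPochhammer ℂ k).eval ((s + 1) / 2) * ((ascPochhammer ℂ k).eval ((s + 1) / 2))⁻¹) =
      (ascPochhammer ℂ k).eval ((s - β + 1) / 2) *
        ((ascPochhammer ℂ k).eval ((s - β + 1) / 2))⁻¹ *
      ((ascPochhammer ℂ k).eval ((s - α + 1) / 2) *
        ((ascPochhammer ℂ k).eval ((s - α + 1) / 2))⁻¹) := by
    rw [mul_inv_cancel₀ e1, mul_inv_cancel₀ e2, mul_inv_cancel₀ e3, mul_inv_cancel₀ e4]
  rw [div_eq_mul_inv _ (_ * _ * _ : ℂ), mul_inv, mul_inv]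
  linear_combination
    (ascPochhammer ℂ k).eval ((α + β - 1) / 2) * (ascPochhammer ℂ k).eval ((s - α) / 2) *
    (ascPochhammer ℂ k).eval ((s - β) / 2) * (k ! : ℂ)⁻¹ * (4 ^ k) ^ 2 * Gamma s *
    (ascPochhammer ℂ k).eval ((γ - 1) / 2) * (ascPochhammer ℂ k).eval (γ / 2) * Gamma (γ - 1) *
    (Gamma (s - α + (2 * k : ℕ)))⁻¹ * (Gamma (s - β + (2 * k : ℕ)))⁻¹ * e

theorem summable_clausenTerm_one {a₁ a₂ a₃ b₁ b₂ : ℂ} (h : (a₁ + a₂ + a₃).re < (b₁ + b₂).re) :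
    Summable (clausenTerm a₁ a₂ a₃ b₁ b₂ 1) := by
  refine (summable_ascPochhammer_ratio (a₁ := a₁) (a₂ := a₂) (a₃ := a₃) (b₁ := b₁) (b₂ := b₂)
    (b₃ := 1) ?_).congr fun k => ?_
  · simp at h ⊢
    linarith
  · rw [clausenTerm, ascPochhammer_eval_one, one_pow, mul_one, div_eq_mul_inv, mul_inv, mul_inv]
    ring


end HypergeometricExpansion

theorem mainTheorem7 (a q α β γ δ ε : ℂ)
    (hFuchs : 1 + α + β = γ + δ + ε)
    (ha : a = 1 / 2) (hγδ : γ + δ = 2) (hq : q = a * α * β + a * (1 - δ) * ε)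
    (hγ : 1 < γ.re)
    (hγε : ∀ m : ℕ, γ + ε ≠ -(m : ℂ))
    (hγα : ∀ m : ℕ, (γ + α) / 2 ≠ -(m : ℂ))
    (hγβ : ∀ m : ℕ, (γ + β) / 2 ≠ -(m : ℂ)) :
    (∀ z : ℂ, ‖z‖ ≤ 1 →
      (∀ n : ℕ, Summable fun j : ℕ =>
        ordinaryHypergeometricCoefficient α β (γ + ε + n) j * z ^ j) ∧
      Summable (heunTerm a q α β γ δ ε z)) ∧
    ContinuousWithinAt (heunExpansion a q α β γ δ ε) (Metric.closedBall 0 1) 1 ∧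
    Summable (clausenTerm ((γ - 1) / 2) (γ / 2) (ε / 2) ((γ + α) / 2) ((γ + β) / 2) 1) ∧
    heunExpansion a q α β γ δ ε 1 =
      Complex.Gamma (γ + ε) * Complex.Gamma (γ - 1) /
          (Complex.Gamma (γ + ε - α) * Complex.Gamma (γ - 1 + α)) *
        clausen ((γ - 1) / 2) (γ / 2) (ε / 2) ((γ + α) / 2) ((γ + β) / 2) 1 := by
  obtain rfl : δ = 2 - γ := by linear_combination hγδ
  obtain rfl : ε = α + β - 1 := by linear_combination -hFuchs
  subst ha hq
  have hre (n : ℕ) : (α + β).re < (γ + (α + β - 1) + n).re := by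
    have h2 : (0 : ℝ) ≤ n := Nat.cast_nonneg n
    simp
    linarith
  obtain ⟨C, hC⟩ := exists_norm_ordinaryHypergeometric_add_natCast_le (a := α) (b := β)
    (c := γ + (α + β - 1)) (by simpa using hre 0)
  have hS := (summable_heunCoeff_special (α := α) (β := β) (γ := γ)).norm.mul_right C
  have hle (n : ℕ) (z : ℂ) (hz : ‖z‖ ≤ 1) :
      ‖heunTerm (1 / 2) (1 / 2 * α * β + 1 / 2 * (1 - (2 - γ)) * (α + β - 1)) α β γ (2 - γ)
        (α + β - 1) z n‖ ≤ _ :=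
    (norm_mul _ _).trans_le (mul_le_mul_of_nonneg_left (hC n z hz) (norm_nonneg _))
  refine ⟨fun z hz => ⟨fun n => ?_, ?_⟩, ?_, ?_, ?_⟩
  · exact (summable_ordinaryHypergeometricCoefficient (hre n)).norm.of_norm_bounded
      fun j => norm_coefficient_mul_pow_le _ _ _ hz j
  · exact hS.of_norm_bounded fun n => hle n z hz
  · refine ContinuousOn.continuousWithinAt (continuousOn_tsum (fun n => ?_) hS fun n z hz =>
      hle n z (by simpa using hz)) (by simp)
    exact (continuousOn_ordinaryHypergeometric (hre n)).const_mul _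
  · refine summable_clausenTerm_one ?_
    -- The lower parameters exceed the upper ones by exactly `1` in total.
    rw [show (γ + α) / 2 + (γ + β) / 2 =
      (γ - 1) / 2 + γ / 2 + (α + β - 1) / 2 + 1 by ring, Complex.add_re _ 1]
    simp
  · rw [heunExpansion, clausen, ← tsum_mul_left, ← (mul_right_injective₀
      (two_ne_zero : (2 : ℕ) ≠ 0)).tsum_eq]
    · exact tsum_congr fun k => heunTerm_one_even_special hγ hγε hγα hγβ k
    · intro n hn
      rcases n.even_or_odd' with ⟨k, rfl | rfl⟩
      · exact ⟨k, rfl⟩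
      · exact (hn (by simp only [heunTerm, heunCoeff_odd_special, zero_mul])).elim
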